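/- **Proposition 1.5.** For a finite group $G$, let $\Delta(G)$ be the simple graph whose vertices are the proper subgroups of $G$, two vertices $H$ and $K$ being joined by an edge if and only if $G=\langle H,K\rangle$. A finite group is called a *$P$-group* if it is either an elementary abelian $p$-group for some prime $p$ (possibly trivial), or a semidirect product $A\rtimes Q$ of an elementary abelian normal $p$-subgroup $A$, $p$ a prime, by a group $Q$ of prime order $q\neq p$ such that every element of $Q$ induces by conjugation a power automorphism on $A$ (an automorphism mapping each subgroup of $A$ onto itself) and the action of $Q$ on $A$ is nontrivial. Let $G$ be a finite group whose Frattini subgroup is trivial. Then there exists a finite nilpotent group $X$ with $\Delta(G)\cong\Delta(X)$ if and only if $G$ is (isomorphic to) a direct product of finitely many $P$-groups with pairwise coprime orders. -/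

import Mathlib

universe u

namespace FiniteGroup

/-- The join graph `Δ(G)` of a group `G`: the vertices are the proper subgroups of `G`, and `H`, `K`
are joined by an edge if and only if they generate `G`. -/
def joinGraph (G : Type*) [Group G] : SimpleGraph {H : Subgroup G // H ≠ ⊤} where
  Adj H K := H.1 ⊔ K.1 = ⊤
  symm := ⟨fun H K h => (sup_comm K.1 H.1).trans h⟩
  loopless := ⟨fun H h => H.2 ((sup_idem H.1).symm.trans h)⟩

/-- The class of the groups `G` such that `Δ(G)` is isomorphic to `Δ(X)` for some finite nilpotent
group `X`. -/
def HasNilpotentJoinGraph (G : Type u) [Group G] : Prop :=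
  ∃ (X : Type u) (_ : Group X),
    Finite X ∧ Group.IsNilpotent X ∧ Nonempty (joinGraph G ≃g joinGraph X)

/-- `A` is an elementary abelian `p`-group (the trivial group is allowed). -/
structure IsElementaryAbelian (p : ℕ) (A : Type*) [Group A] : Prop where
  prime : p.Prime
  comm : ∀ a b : A, a * b = b * a
  pow_eq_one : ∀ a : A, a ^ p = 1

/-- A power automorphism of `A` is an automorphism that maps every subgroup of `A` onto itself. -/
def IsPowerAutomorphism {A : Type*} [Group A] (φ : MulAut A) : Prop :=
  ∀ B : Subgroup A, B.map φ.toMonoidHom = B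

/-- `G` is the internal semidirect product of an elementary abelian normal `p`-subgroup `A` by a
subgroup `Q` of prime order `q ≠ p` that induces, by conjugation, a nontrivial group of power
automorphisms on `A`. -/
def IsNonabelianPGroup (G : Type*) [Group G] : Prop :=
  ∃ (p q : ℕ) (A Q : Subgroup G) (_ : A.Normal),
    IsElementaryAbelian p A ∧ q.Prime ∧ q ≠ p ∧ Nat.card Q = q ∧ A.IsComplement' Q ∧
    (∀ x ∈ Q, IsPowerAutomorphism (MulAut.conjNormal x : MulAut A)) ∧
    (∃ x ∈ Q, (MulAut.conjNormal x : MulAut A) ≠ 1)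

/-- A finite group is a `P`-group if it is an elementary abelian `p`-group for some prime `p` or a
semidirect product as in `IsNonabelianPGroup`. (This is not the notion of a `p`-group.) -/
def IsBaerPGroup (G : Type*) [Group G] : Prop :=
  Finite G ∧ ((∃ p : ℕ, IsElementaryAbelian p G) ∨ IsNonabelianPGroup G)

/-- `G` is isomorphic to a direct product of finitely many `P`-groups of pairwise coprime orders. -/
def IsCoprimeProductOfPGroups (G : Type u) [Group G] : Prop :=
  ∃ (n : ℕ) (H : Fin n → Type u) (_ : ∀ i, Group (H i)),
    (∀ i, IsBaerPGroup (H i)) ∧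
    (∀ i j, i ≠ j → (Nat.card (H i)).Coprime (Nat.card (H j))) ∧
    Nonempty (G ≃* (∀ i, H i))

end FiniteGroup

/-! When `Φ(G) = 1` and `X` is nilpotent, the graph remembers the whole subgroup lattice. The
isolated vertices are the proper subgroups inside the Frattini subgroup, so `Φ(X) = 1`. Hence `X` is
abelian with elementary abelian primary components, and each of its subgroups is an intersection of
maximal ones. Inclusion of neighbourhoods then is inclusion of subgroups, and the graph isomorphism
becomes a lattice isomorphism (`nonempty_subgroup_orderIso_of_joinGraph_iso`).

It remains to see which groups have the subgroup lattice of such an `X`. The images in `G` of the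
primary components commute, have coprime orders and generate `G`
(`commute_and_coprime_of_orderIso`). Each is a `P`-group (`isBaerPGroup_of_orderIso`): two minimal
subgroups generate a group with exactly `p + 1` minimal subgroups and nothing else between `⊥` and
`⊤`, and counting conjugates determines its structure (`IsLine.structure_of_isLine`).

Conversely, a nonabelian `A ⋊ Q` has the subgroup lattice of `A × ZMod p`, by pulling subspaces back
along a crossed homomorphism. Coprime products of groups give products of lattices, hence the
lattice of an abelian group. -/

namespace FiniteGroup

/-! ### Minimal subgroups and prime order -/

section Atoms

variable {G : Type*} [Group G]

theorem isAtom_of_card_prime {K : Subgroup G} (h : (Nat.card K).Prime) : IsAtom K := by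
  have : Finite K := Nat.finite_of_card_ne_zero h.ne_zero
  refine ⟨fun hK => ?_, fun B hB => ?_⟩
  · subst hK
    simp [Nat.not_prime_one] at h
  · rcases (Nat.dvd_prime h).1 (Subgroup.card_dvd_of_le hB.le) with h1 | h1
    · exact Subgroup.card_eq_one.1 h1
    · exact absurd (Subgroup.eq_of_le_of_card_ge hB.le h1.ge) hB.ne

theorem isAtom_iff_card_prime [Finite G] {K : Subgroup G} : IsAtom K ↔ (Nat.card K).Prime := by
  refine ⟨fun h => ?_, isAtom_of_card_prime⟩
  have hK : Nat.card K ≠ 1 := fun h1 => h.1 (Subgroup.card_eq_one.1 h1)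
  obtain ⟨r, hr, hrK⟩ := Nat.exists_prime_and_dvd hK
  have : Fact r.Prime := ⟨hr⟩
  obtain ⟨x, hx⟩ := exists_prime_orderOf_dvd_card' r hrK
  have hxo : orderOf (x : G) = r := by rw [Subgroup.orderOf_coe, hx]
  have hle : Subgroup.zpowers (x : G) ≤ K := by simp
  have hne : Subgroup.zpowers (x : G) ≠ ⊥ := by
    intro h0
    have : (x : G) = 1 := by simpa using h0
    rw [this, orderOf_one] at hxo
    exact hr.one_lt.ne hxo
  rw [← (h.le_iff_eq hne).1 hle, Nat.card_zpowers, hxo]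
  exact hr

theorem isAtom_zpowers {x : G} (hx : (orderOf x).Prime) : IsAtom (Subgroup.zpowers x) :=
  isAtom_of_card_prime (by rwa [Nat.card_zpowers])

theorem exists_zpowers_eq_of_isAtom {K : Subgroup G} (h : IsAtom K) :
    ∃ x ∈ K, Subgroup.zpowers x = K := by
  obtain ⟨x, hx1⟩ := Subgroup.ne_bot_iff_exists_ne_one.1 h.1
  exact ⟨x, x.2, (h.le_iff_eq (by simpa using hx1)).1 (by simp)⟩

end Atoms

/-! ### Nilpotent groups with trivial Frattini subgroup -/

section Nilpotent

variable {X : Type*} [Group X]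

theorem isAtom_top_quotient {M : Subgroup X} [M.Normal] (hM : IsCoatom M) :
    IsAtom (⊤ : Subgroup (X ⧸ M)) := by
  refine ⟨fun h => hM.1 ?_, fun B hB => ?_⟩
  · rw [eq_comm] at h
    have := congrArg (Subgroup.comap (QuotientGroup.mk' M)) h
    rwa [MonoidHom.comap_bot, QuotientGroup.ker_mk', Subgroup.comap_top] at this
  · have hle : M ≤ B.comap (QuotientGroup.mk' M) := QuotientGroup.le_comap_mk' M B
    rcases hle.eq_or_lt with h | h
    · have := congrArg (Subgroup.map (QuotientGroup.mk' M)) h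
      rw [Subgroup.map_comap_eq_self_of_surjective (QuotientGroup.mk'_surjective M)] at this
      rw [← this]
      simp
    · have h1 := hM.2 _ h
      have := congrArg (Subgroup.map (QuotientGroup.mk' M)) h1
      rw [Subgroup.map_comap_eq_self_of_surjective (QuotientGroup.mk'_surjective M),
        Subgroup.map_top_of_surjective _ (QuotientGroup.mk'_surjective M)] at this
      exact absurd this hB.ne

theorem mem_frattini_iff {x : X} : x ∈ frattini X ↔ ∀ M : Subgroup X, IsCoatom M → x ∈ M := by
  simp [frattini, Order.radical, Subgroup.mem_iInf]

theorem normal_of_isCoatom [Group.IsNilpotent X] {M : Subgroup X} (hM : IsCoatom M) : M.Normal :=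
  Subgroup.NormalizerCondition.normal_of_coatom M Group.normalizerCondition_of_isNilpotent hM

variable [Finite X] [Group.IsNilpotent X]

theorem index_prime_of_isCoatom {M : Subgroup X} (hM : IsCoatom M) : M.index.Prime := by
  have := normal_of_isCoatom hM
  have h := isAtom_iff_card_prime.1 (isAtom_top_quotient hM)
  rwa [Subgroup.card_top] at h

theorem commute_of_frattini_eq_bot (h : frattini X = ⊥) (x y : X) : x * y = y * x := by
  -- Every maximal subgroup is normal of prime index, so its quotient is cyclic and kills the
  -- commutator.
  have key : x * y * (y * x)⁻¹ ∈ frattini X := by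
    refine mem_frattini_iff.2 fun M hM => ?_
    have := normal_of_isCoatom hM
    have : Fact M.index.Prime := ⟨index_prime_of_isCoatom hM⟩
    have hc : IsCyclic (X ⧸ M) := isCyclic_of_prime_card (p := M.index) rfl
    rw [← QuotientGroup.eq_one_iff]
    have := hc.isMulCommutative.is_comm.comm (x : X ⧸ M) y
    simp only [QuotientGroup.mk_mul, QuotientGroup.mk_inv]
    rw [this, mul_inv_cancel]
  rw [h, Subgroup.mem_bot] at key
  exact mul_inv_eq_one.1 key

theorem pow_prime_eq_one_of_frattini_eq_bot (h : frattini X = ⊥) {p k : ℕ} (hp : p.Prime) {x : X}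
    (hx : x ^ p ^ k = 1) : x ^ p = 1 := by
  have key : x ^ p ∈ frattini X := by
    refine mem_frattini_iff.2 fun M hM => ?_
    have := normal_of_isCoatom hM
    have hr := index_prime_of_isCoatom hM
    rw [← QuotientGroup.eq_one_iff, QuotientGroup.mk_pow]
    have h1 : (x : X ⧸ M) ^ p ^ k = 1 := by rw [← QuotientGroup.mk_pow, hx]; rfl
    have h2 : (x : X ⧸ M) ^ M.index = 1 := pow_card_eq_one'
    obtain ⟨j, -, hj⟩ := (Nat.dvd_prime_pow hp).1 (orderOf_dvd_of_pow_eq_one h1)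
    rcases (Nat.dvd_prime hr).1 (orderOf_dvd_of_pow_eq_one h2) with h3 | h3
    · rw [orderOf_eq_one_iff.1 h3, one_pow]
    · apply orderOf_dvd_iff_pow_eq_one.1
      have h4 : M.index ∣ p ^ j := by rw [← hj, h3]
      rw [h3, (Nat.prime_dvd_prime_iff_eq hr hp).1 (hr.dvd_of_dvd_pow h4)]
  rwa [h, Subgroup.mem_bot] at key

end Nilpotent

section Lattice

variable {X : Type*} [CommGroup X] [Finite X]

/-- The lattice is modular because the group is abelian. In its dual the top is a join of atoms,
which forces complements and hence atomisticity. -/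
theorem isCoatomistic_of_frattini_eq_bot (h : frattini X = ⊥) : IsCoatomistic (Subgroup X) := by
  have h1 : sSup {a : (Subgroup X)ᵒᵈ | IsAtom a} = ⊤ := by
    have : sInf {a : Subgroup X | IsCoatom a} = ⊥ := by
      rw [← h, frattini, Order.radical, sInf_eq_iInf]
    exact congrArg OrderDual.toDual this
  have : IsCompactlyGenerated (Subgroup X)ᵒᵈ :=
    CompleteLattice.isCompactlyGenerated_of_wellFoundedGT
  have : ComplementedLattice (Subgroup X)ᵒᵈ := complementedLattice_of_sSup_atoms_eq_top h1
  exact isAtomistic_dual_iff_isCoatomistic.1 inferInstance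

end Lattice

/-! ### From the join graph to the subgroup lattice -/

section JoinGraph

variable {G : Type*} [Group G] {X : Type*} [Group X]

theorem joinGraph_not_adj_iff [Finite G] {H K : {H : Subgroup G // H ≠ ⊤}} :
    ¬ (joinGraph G).Adj H K ↔ ∃ M : Subgroup G, IsCoatom M ∧ H.1 ≤ M ∧ K.1 ≤ M := by
  constructor
  · intro h
    obtain h1 | ⟨M, hM, hle⟩ := eq_top_or_exists_le_coatom (H.1 ⊔ K.1)
    · exact absurd h1 h
    · exact ⟨M, hM, le_sup_left.trans hle, le_sup_right.trans hle⟩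
  · rintro ⟨M, hM, h1, h2⟩ h
    exact hM.1 (top_le_iff.1 (h.ge.trans (sup_le h1 h2)))

/-- A maximal subgroup containing `K` but not `H` is itself a vertex adjacent to `H` and not to `K`.
-/
theorem neighborSet_joinGraph_subset_iff [Finite G] {H K : {H : Subgroup G // H ≠ ⊤}} :
    (joinGraph G).neighborSet H ⊆ (joinGraph G).neighborSet K ↔
      ∀ M : Subgroup G, IsCoatom M → K.1 ≤ M → H.1 ≤ M := by
  constructor
  · intro h M hM hK
    by_contra hH
    have h1 : (joinGraph G).Adj H ⟨M, hM.1⟩ :=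
      hM.2 _ (right_lt_sup.2 hH)
    have h2 := h h1
    have h3 : K.1 ⊔ M = ⊤ := h2
    rw [sup_eq_right.2 hK] at h3
    exact hM.1 h3
  · intro h L hL
    by_contra hL'
    obtain ⟨M, hM, h1, h2⟩ := joinGraph_not_adj_iff.1 hL'
    exact joinGraph_not_adj_iff.2 ⟨M, hM, h M hM h1, h2⟩ hL

theorem neighborSet_joinGraph_eq_empty_iff [Finite G] {H : {H : Subgroup G // H ≠ ⊤}} :
    (joinGraph G).neighborSet H = ∅ ↔ H.1 ≤ frattini G := by
  have hn : Nontrivial (Subgroup G) := ⟨H.1, ⊤, H.2⟩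
  have hb : (joinGraph G).neighborSet ⟨⊥, bot_ne_top⟩ = ∅ := by
    ext K
    have : ¬ (⊥ : Subgroup G) ⊔ K.1 = ⊤ := by rw [bot_sup_eq]; exact K.2
    exact iff_of_false this (Set.notMem_empty _)
  rw [← Set.subset_empty_iff, ← hb, neighborSet_joinGraph_subset_iff, frattini, Order.radical]
  simp

theorem neighborSet_subset_iff_of_iso {V W : Type*} {Γ : SimpleGraph V} {Γ' : SimpleGraph W}
    (e : Γ ≃g Γ') {v w : V} :
    Γ'.neighborSet (e v) ⊆ Γ'.neighborSet (e w) ↔ Γ.neighborSet v ⊆ Γ.neighborSet w := by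
  constructor
  · intro h x hx
    exact e.map_adj_iff.1 (h (e.map_adj_iff.2 hx))
  · intro h y hy
    obtain ⟨x, rfl⟩ := e.surjective y
    exact e.map_adj_iff.2 (h (e.map_adj_iff.1 hy))

/-- A nontrivial `Φ(X)` would give two isolated vertices, `⊥` and `Φ(X)`, whereas `G` has at most
one. -/
theorem frattini_eq_bot_of_iso [Finite G] [Finite X] (hG : frattini G = ⊥)
    (e : joinGraph G ≃g joinGraph X) : frattini X = ⊥ := by
  by_contra hne
  have hn : Nontrivial (Subgroup X) := ⟨_, _, hne⟩
  have hft : frattini X ≠ ⊤ := by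
    intro h
    obtain h1 | ⟨M, hM, -⟩ := eq_top_or_exists_le_coatom (⊥ : Subgroup X)
    · exact bot_ne_top h1
    · exact hM.1 (top_le_iff.1 (h.ge.trans (frattini_le_coatom hM)))
  have key : ∀ H : {H : Subgroup X // H ≠ ⊤}, H.1 ≤ frattini X → (e.symm H).1 = ⊥ := by
    intro H hH
    rw [← le_bot_iff, ← hG, ← neighborSet_joinGraph_eq_empty_iff]
    have h1 := neighborSet_joinGraph_eq_empty_iff.2 hH
    rw [Set.eq_empty_iff_forall_notMem] at h1 ⊢
    intro x hx
    refine h1 (e x) ?_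
    have := e.map_adj_iff.2 hx
    rwa [RelIso.apply_symm_apply] at this
  have h1 := key ⟨frattini X, hft⟩ le_rfl
  have h2 := key ⟨⊥, bot_ne_top⟩ bot_le
  have h3 := e.symm.injective (Subtype.ext (h1.trans h2.symm))
  exact hne (congrArg Subtype.val h3)

theorem nonempty_subgroup_orderIso_of_joinGraph_iso [Finite G] [Finite X]
    (hX : IsCoatomistic (Subgroup X)) (e : joinGraph G ≃g joinGraph X) :
    Nonempty (Subgroup G ≃o Subgroup X) := by
  classical
  have hX' : ∀ H K : {H : Subgroup X // H ≠ ⊤},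
      (joinGraph X).neighborSet H ⊆ (joinGraph X).neighborSet K ↔ H ≤ K := by
    intro H K
    rw [neighborSet_joinGraph_subset_iff]
    refine ⟨fun h => ?_, fun h M _ hK => le_trans h hK⟩
    change H.1 ≤ K.1
    obtain ⟨s, hs, hs'⟩ := eq_sInf_coatoms K.1
    rw [hs]
    exact le_sInf fun M hM => h M (hs' M hM) (hs.le.trans (sInf_le hM))
  have hG' : ∀ H K : {H : Subgroup G // H ≠ ⊤},
      (joinGraph G).neighborSet H ⊆ (joinGraph G).neighborSet K ↔ H ≤ K := by
    intro H K
    rw [neighborSet_joinGraph_subset_iff]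
    refine ⟨fun h => ?_, fun h M _ hK => le_trans h hK⟩
    obtain h1 | ⟨M, hM, hle⟩ := eq_top_or_exists_le_coatom K.1
    · exact absurd h1 K.2
    -- `H ⊔ K` is a vertex with the same neighbours as `K`. Distinct vertices of `X` have distinct
    -- neighbourhoods, so the same holds in `G` and `H ⊔ K = K`.
    have hsup : H.1 ⊔ K.1 ≠ ⊤ := fun h0 =>
      hM.1 (top_le_iff.1 (h0.ge.trans (sup_le (h M hM hle) hle)))
    have h1 : (joinGraph G).neighborSet ⟨H.1 ⊔ K.1, hsup⟩ ⊆ (joinGraph G).neighborSet K :=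
      neighborSet_joinGraph_subset_iff.2 fun M hM hK => sup_le (h M hM hK) hK
    have h2 : (joinGraph G).neighborSet K ⊆ (joinGraph G).neighborSet ⟨H.1 ⊔ K.1, hsup⟩ :=
      neighborSet_joinGraph_subset_iff.2 fun M hM hK => le_sup_right.trans hK
    rw [← neighborSet_subset_iff_of_iso e, hX'] at h1 h2
    have h3 := congrArg Subtype.val (e.injective (le_antisymm h1 h2))
    exact sup_eq_right.1 h3
  let e' : {H : Subgroup G // H ≠ ⊤} ≃o {H : Subgroup X // H ≠ ⊤} :=
    { toEquiv := e.toEquiv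
      map_rel_iff' := fun {H K} => by
        rw [← hX', ← hG']
        exact neighborSet_subset_iff_of_iso e }
  exact ⟨(WithTop.subtypeOrderIso.symm.trans e'.withTopCongr).trans WithTop.subtypeOrderIso⟩

theorem nonempty_joinGraph_iso_of_subgroup_orderIso (f : Subgroup G ≃o Subgroup X) :
    Nonempty (joinGraph G ≃g joinGraph X) := by
  refine ⟨⟨f.toEquiv.subtypeEquiv fun H => not_congr (by simp), fun {H K} => ?_⟩⟩
  change f H.1 ⊔ f K.1 = ⊤ ↔ H.1 ⊔ K.1 = ⊤
  rw [← map_sup, map_eq_top_iff]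

end JoinGraph

/-! ### Conjugating and counting minimal subgroups -/

section AtomLemmas

variable {G : Type*} [Group G]

theorem zpowers_eq_of_mem_isAtom {K : Subgroup G} (hK : IsAtom K) {x : G} (hx : x ∈ K)
    (h1 : x ≠ 1) : Subgroup.zpowers x = K :=
  (hK.le_iff_eq (by simpa using h1)).1 (by simpa using hx)

theorem eq_of_mem_of_isAtom {K L : Subgroup G} (hK : IsAtom K) (hL : IsAtom L) {x : G}
    (hxK : x ∈ K) (hxL : x ∈ L) (h1 : x ≠ 1) : K = L :=
  (zpowers_eq_of_mem_isAtom hK hxK h1).symm.trans (zpowers_eq_of_mem_isAtom hL hxL h1)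

theorem isAtom_map_conj {K : Subgroup G} (hK : IsAtom K) (g : G) :
    IsAtom (K.map (MulAut.conj g).toMonoidHom) :=
  ((MulAut.conj g).mapSubgroup.isAtom_iff K).2 hK

theorem card_eq_mul_of_isAtom [Finite G] {N K : Subgroup G} [N.Normal] (hN : IsAtom N)
    (hK : IsAtom K) (hne : N ≠ K) (h : N ⊔ K = ⊤) : Nat.card G = Nat.card N * Nat.card K := by
  refine (Subgroup.IsComplement'.card_mul_card
    (Subgroup.isComplement'_of_disjoint_and_mul_eq_univ (hN.disjoint_of_ne hK hne) ?_)).symm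
  rw [← Subgroup.normal_mul, h, Subgroup.coe_top]

theorem normal_of_conj_mem {P R : Subgroup G} (h : P ⊔ R = ⊤)
    (hc : ∀ x ∈ P, ∀ y ∈ R, x * y * x⁻¹ ∈ R) : R.Normal := by
  rw [← Subgroup.normalizer_eq_top_iff, ← top_le_iff, ← h]
  refine sup_le (fun x hx => ?_) Subgroup.le_normalizer
  rw [Subgroup.mem_normalizer_iff]
  refine fun y => ⟨hc x hx y, fun hy => ?_⟩
  have := hc x⁻¹ (inv_mem hx) _ hy
  simpa [mul_assoc] using this

/-- In a group of order `p ^ 2` and exponent `p`, there are `p` subgroups of order `p` different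
from a given one. -/
theorem card_atoms_ne_of_card_sq [Finite G] {p : ℕ} (hp : p.Prime) (hG : Nat.card G = p ^ 2)
    (hexp : ∀ x : G, x ^ p = 1) {P : Subgroup G} (hP : IsAtom P) :
    Nat.card {K : Subgroup G // IsAtom K ∧ K ≠ P} = p := by
  have : Fact p.Prime := ⟨hp⟩
  have hord : ∀ x : G, x ≠ 1 → orderOf x = p := fun x hx => orderOf_eq_prime (hexp x) hx
  have hcard : ∀ K : Subgroup G, IsAtom K → Nat.card K = p := by
    intro K hK
    obtain ⟨x, hx, rfl⟩ := exists_zpowers_eq_of_isAtom hK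
    rw [Nat.card_zpowers, hord x]
    rintro rfl
    exact hK.1 (by simp)
  -- The `p ^ 2 - p` elements outside `P` are partitioned by the other minimal subgroups, with `p -
  -- 1` in each.
  let φ : (Σ K : {K : Subgroup G // IsAtom K ∧ K ≠ P}, {x : K.1 // x ≠ 1}) → {x : G // x ∉ P} :=
    fun z => ⟨z.2.1.1, fun h => z.1.2.2 (eq_of_mem_of_isAtom z.1.2.1 hP z.2.1.2 h
      (by simpa using z.2.2))⟩
  have hφ : Function.Bijective φ := by
    constructor
    · rintro ⟨⟨K, hK, hKP⟩, ⟨x, hx⟩, hx1⟩ ⟨⟨L, hL, hLP⟩, ⟨y, hy⟩, hy1⟩ h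
      have hxy : x = y := congrArg Subtype.val h
      subst hxy
      obtain rfl := eq_of_mem_of_isAtom hK hL hx hy (by simpa using hx1)
      rfl
    · rintro ⟨x, hx⟩
      have hx1 : x ≠ 1 := fun h => hx (h ▸ one_mem P)
      refine ⟨⟨⟨Subgroup.zpowers x, isAtom_zpowers (by rwa [hord x hx1]), ?_⟩,
        ⟨⟨x, Subgroup.mem_zpowers x⟩, by simpa using hx1⟩⟩, rfl⟩
      rintro rfl
      exact hx (Subgroup.mem_zpowers x)
  have h1 := Nat.card_congr (Equiv.ofBijective φ hφ)
  have : Fintype {K : Subgroup G // IsAtom K ∧ K ≠ P} := Fintype.ofFinite _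
  have h2 : ∀ K : {K : Subgroup G // IsAtom K ∧ K ≠ P}, Nat.card {x : K.1 // x ≠ 1} = p - 1 := by
    intro K
    have h := Set.ncard_compl ({1} : Set K.1)
    rw [Set.ncard_singleton, hcard _ K.2.1] at h
    exact h
  have h3 : Nat.card {x : G // x ∉ P} = p ^ 2 - p := by
    have h := Set.ncard_compl (P : Set G)
    rw [hG] at h
    have h' : (P : Set G).ncard = p := hcard P hP
    rw [h'] at h
    exact h
  rw [Nat.card_sigma, Finset.sum_congr rfl (fun K _ => h2 K), h3, Finset.sum_const,
    Finset.card_univ, smul_eq_mul, ← Nat.card_eq_fintype_card] at h1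
  have h4 : p ^ 2 - p = p * (p - 1) := by rw [Nat.mul_sub, sq, mul_one]
  rw [h4] at h1
  exact Nat.eq_of_mul_eq_mul_right (Nat.sub_pos_of_lt hp.one_lt) h1

end AtomLemmas

/-- A lattice of length two in which there are `p` atoms different from any given one. -/
structure IsLine (p : ℕ) (L : Type*) [Lattice L] [BoundedOrder L] : Prop where
  bot_ne_top : (⊥ : L) ≠ ⊤
  not_isAtom_top : ¬ IsAtom (⊤ : L)
  eq_bot_or : ∀ a : L, a = ⊥ ∨ IsAtom a ∨ a = ⊤
  card : ∀ a : L, IsAtom a → Nat.card {b : L // IsAtom b ∧ b ≠ a} = p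

/-! ### Groups whose subgroup lattice is a line -/

namespace IsLine

section Lattice

variable {p : ℕ} {L L' : Type*} [Lattice L] [BoundedOrder L] [Lattice L'] [BoundedOrder L']

theorem of_orderIso (h : IsLine p L) (f : L ≃o L') : IsLine p L' where
  bot_ne_top h' := h.bot_ne_top (f.injective (by simpa using h'))
  not_isAtom_top h' := h.not_isAtom_top (by rw [← f.isAtom_iff]; simpa using h')
  eq_bot_or a := by
    rcases h.eq_bot_or (f.symm a) with h1 | h1 | h1
    · left; simpa using h1
    · right; left; rwa [OrderIso.isAtom_iff] at h1
    · right; right; simpa using h1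
  card a ha := by
    rw [← h.card (f.symm a) ((f.symm.isAtom_iff a).2 ha)]
    refine Nat.card_congr (f.symm.toEquiv.subtypeEquiv fun b => ?_)
    simp

theorem sup_eq_top (h : IsLine p L) {a b : L} (ha : IsAtom a) (hb : IsAtom b) (hab : a ≠ b) :
    a ⊔ b = ⊤ := by
  rcases h.eq_bot_or (a ⊔ b) with h1 | h1 | h1
  · exact absurd (le_bot_iff.1 (h1 ▸ le_sup_left)) ha.1
  · exact absurd ((h1.le_iff_eq ha.1).1 le_sup_left |>.trans
      ((h1.le_iff_eq hb.1).1 le_sup_right).symm) hab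
  · exact h1

end Lattice

theorem of_card_sq {E : Type*} [Group E] [Finite E] {p : ℕ} (hp : p.Prime)
    (hE : Nat.card E = p ^ 2) (hexp : ∀ x : E, x ^ p = 1) : IsLine p (Subgroup E) where
  bot_ne_top h := by
    have := congrArg (fun K : Subgroup E => Nat.card K) h
    simp only [Subgroup.card_bot, Subgroup.card_top, hE] at this
    exact (Nat.one_lt_pow two_ne_zero hp.one_lt).ne this
  not_isAtom_top h := by
    rw [isAtom_iff_card_prime, Subgroup.card_top, hE] at h
    exact Nat.Prime.not_prime_pow le_rfl h
  eq_bot_or K := by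
    obtain ⟨k, hk, hK⟩ := (Nat.dvd_prime_pow hp).1 (hE ▸ Subgroup.card_subgroup_dvd_card K)
    interval_cases k
    · left; exact Subgroup.card_eq_one.1 (by simpa using hK)
    · right; left; exact isAtom_iff_card_prime.2 (by rw [hK, pow_one]; exact hp)
    · right; right; exact Subgroup.eq_top_of_card_eq _ (hK.trans hE.symm)
  card _ hP := card_atoms_ne_of_card_sq hp hE hexp hP

variable {T : Type*} [Group T] [Finite T] {p : ℕ}

/-- A subgroup of prime order normalizing no other minimal subgroup has order `p`, as it permutes
the `p` other minimal subgroups. -/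
theorem card_eq_of_forall_not_conj_mem (h : IsLine p (Subgroup T)) (hp : p.Prime) {P : Subgroup T}
    (hP : IsAtom P)
    (hno : ∀ R : Subgroup T, IsAtom R → R ≠ P → ¬ ∀ x ∈ P, ∀ y ∈ R, x * y * x⁻¹ ∈ R) :
    Nat.card P = p := by
  have hr := isAtom_iff_card_prime.1 hP
  have hPP : ∀ x ∈ P, P.map (MulAut.conj x).toMonoidHom = P := by
    intro x hx
    exact Subgroup.mem_normalizer_iff_map_conj_eq.1 (Subgroup.le_normalizer hx)
  let act : MulAction P {K : Subgroup T // IsAtom K ∧ K ≠ P} :=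
    { smul := fun x K => ⟨K.1.map (MulAut.conj x.1).toMonoidHom, isAtom_map_conj K.2.1 _, by
        intro h0
        refine K.2.2 ((MulAut.conj x.1).mapSubgroup.injective ?_)
        exact h0.trans (hPP x.1 x.2).symm⟩
      one_smul := fun K => Subtype.ext (by
        change K.1.map (MulAut.conj (1 : T)).toMonoidHom = K.1
        rw [map_one]
        exact K.1.map_id)
      mul_smul := fun x y K => Subtype.ext (by
        change K.1.map (MulAut.conj (x.1 * y.1)).toMonoidHom =
          (K.1.map (MulAut.conj y.1).toMonoidHom).map (MulAut.conj x.1).toMonoidHom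
        rw [map_mul, Subgroup.map_map]
        rfl) }
  have : Fact (Nat.card P).Prime := ⟨hr⟩
  have hG : IsPGroup (Nat.card P) P := IsPGroup.of_card (n := 1) (by simp)
  by_contra hne
  obtain ⟨R, hR⟩ := hG.nonempty_fixed_point_of_prime_not_dvd_card
    {K : Subgroup T // IsAtom K ∧ K ≠ P} (by
      rw [h.card P hP]
      exact fun hd => hne ((Nat.prime_dvd_prime_iff_eq hr hp).1 hd))
  refine hno R.1 R.2.1 R.2.2 fun x hx y hy => ?_
  have h1 : R.1.map (MulAut.conj x).toMonoidHom = R.1 := congrArg Subtype.val (hR ⟨x, hx⟩)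
  rw [← h1]
  exact ⟨y, hy, rfl⟩

/-- Otherwise no minimal subgroup normalizes another, since the two generate `T`. Then all have
order `p`, so `T` is a `p`-group, and a minimal subgroup of its nontrivial center is normal. -/
theorem exists_normal_isAtom (h : IsLine p (Subgroup T)) (hp : p.Prime) :
    ∃ N : Subgroup T, IsAtom N ∧ N.Normal := by
  by_contra! hno
  have hcard : ∀ P : Subgroup T, IsAtom P → Nat.card P = p := fun P hP =>
    h.card_eq_of_forall_not_conj_mem hp hP fun R hR hne hc =>
      hno R hR (normal_of_conj_mem (h.sup_eq_top hP hR hne.symm) hc)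
  have hT : Nat.card T = p ^ (Nat.card T).primeFactorsList.length := by
    refine Nat.eq_prime_pow_of_unique_prime_dvd Nat.card_pos.ne' fun {d} hd hdT => ?_
    have : Fact d.Prime := ⟨hd⟩
    obtain ⟨x, hx⟩ := exists_prime_orderOf_dvd_card' d hdT
    rw [← hcard _ (isAtom_zpowers (hx.symm ▸ hd)), Nat.card_zpowers, hx]
  have : Fact p.Prime := ⟨hp⟩
  have : Nontrivial (Subgroup T) := ⟨_, _, h.bot_ne_top⟩
  have : Nontrivial T := Subgroup.nontrivial_iff.1 this
  have hc := (IsPGroup.of_card hT).center_nontrivial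
  obtain h1 | ⟨N, hN, hle⟩ := eq_bot_or_exists_atom_le (Subgroup.center T)
  · exact (Subgroup.nontrivial_iff_ne_bot _).1 hc h1
  · refine hno N hN ⟨fun n hn g => ?_⟩
    rw [Subgroup.mem_center_iff.1 (hle hn) g, mul_inv_cancel_right]
    exact hn

/-- Let `N` be a normal minimal subgroup. If a second one, `R`, is normal, comparing both with a
third minimal subgroup gives `|N| = |R|`, so `T` is elementary abelian of order `|N| ^ 2`, and the
count of atoms gives `|N| = p`. If not, `N` normalizes no other minimal subgroup, so `|N| = p`;
another one of order `p`, or one centralized by `N`, would be normal. -/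
theorem structure_of_isLine (h : IsLine p (Subgroup T)) (hp : p.Prime) :
    ((∀ x : T, x ^ p = 1) ∧ ∀ x y : T, x * y = y * x) ∨
    ∃ N : Subgroup T, N.Normal ∧ IsAtom N ∧ Nat.card N = p ∧ ∀ R : Subgroup T, IsAtom R → R ≠ N →
      Nat.card R ≠ p ∧ ∃ n ∈ N, ∃ r ∈ R, n * r ≠ r * n := by
  obtain ⟨N, hN, hNn⟩ := h.exists_normal_isAtom hp
  by_cases hex : ∃ R : Subgroup T, IsAtom R ∧ R ≠ N ∧ R.Normal
  · left
    obtain ⟨R, hR, hRN, hRn⟩ := hex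
    have hcardNR := card_eq_mul_of_isAtom hN hR hRN.symm (h.sup_eq_top hN hR hRN.symm)
    have hNR : Nat.card N = Nat.card R := by
      have h1 : Nat.card {K : Subgroup T // IsAtom K ∧ K ≠ N} ≠ 1 := by
        rw [h.card N hN]
        exact hp.one_lt.ne'
      obtain ⟨K, hK, hKN, hKR⟩ : ∃ K : Subgroup T, IsAtom K ∧ K ≠ N ∧ K ≠ R := by
        by_contra! hno
        refine h1 (Nat.card_eq_one_iff_unique.2 ⟨⟨fun a b => Subtype.ext ?_⟩, ⟨R, hR, hRN⟩⟩)
        rw [hno a.1 a.2.1 a.2.2, hno b.1 b.2.1 b.2.2]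
      have h2 := card_eq_mul_of_isAtom hN hK hKN.symm (h.sup_eq_top hN hK hKN.symm)
      have h3 := card_eq_mul_of_isAtom hR hK hKR.symm (h.sup_eq_top hR hK hKR.symm)
      exact Nat.eq_of_mul_eq_mul_right Nat.card_pos (h2.symm.trans h3)
    have hr := isAtom_iff_card_prime.1 hN
    rw [← hNR, ← sq] at hcardNR
    have : Fact (Nat.card N).Prime := ⟨hr⟩
    have hcomm : ∀ x y : T, x * y = y * x :=
      (IsPGroup.isMulCommutative_of_card_eq_prime_sq hcardNR).is_comm.comm
    have hexp : ∀ x : T, x ^ Nat.card N = 1 := by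
      intro x
      have hx : x ∈ N ⊔ R := by rw [h.sup_eq_top hN hR hRN.symm]; trivial
      obtain ⟨n, hn, r, hr', rfl⟩ := Subgroup.mem_sup_of_normal_left.1 hx
      rw [(show Commute n r from hcomm n r).mul_pow]
      have h1 : n ^ Nat.card N = 1 := congrArg Subtype.val (pow_card_eq_one' (x := (⟨n, hn⟩ : N)))
      have h2 : r ^ Nat.card R = 1 := congrArg Subtype.val (pow_card_eq_one' (x := (⟨r, hr'⟩ : R)))
      rw [h1, hNR, h2, one_mul]
    have hpr : Nat.card N = p := by
      rw [← h.card N hN, card_atoms_ne_of_card_sq hr hcardNR hexp hN]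
    rw [hpr] at hexp
    exact ⟨hexp, hcomm⟩
  · right
    push Not at hex
    have hNp : Nat.card N = p := h.card_eq_of_forall_not_conj_mem hp hN fun R hR hRN hc =>
      hex R hR hRN (normal_of_conj_mem (h.sup_eq_top hN hR hRN.symm) hc)
    refine ⟨N, hNn, hN, hNp, fun R hR hRN => ⟨fun hRp => ?_, ?_⟩⟩
    · have hcard := card_eq_mul_of_isAtom hN hR hRN.symm (h.sup_eq_top hN hR hRN.symm)
      rw [hNp, hRp, ← sq] at hcard
      have : Fact p.Prime := ⟨hp⟩
      have hcomm := (IsPGroup.isMulCommutative_of_card_eq_prime_sq hcard).is_comm.comm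
      refine hex R hR hRN ⟨fun n hn g => ?_⟩
      rw [hcomm g n, mul_inv_cancel_right]
      exact hn
    · by_contra! hc
      refine hex R hR hRN (normal_of_conj_mem (h.sup_eq_top hN hR hRN.symm) fun x hx y hy => ?_)
      rw [hc x hx y hy, mul_inv_cancel_right]
      exact hy

end IsLine

/-- An isomorphism of subgroup lattices restricts to corresponding subgroups. -/
def restrictOrderIso {G X : Type*} [Group G] [Group X] (f : Subgroup X ≃o Subgroup G)
    (H : Subgroup X) : Subgroup H ≃o Subgroup (f H) :=
  ((Subgroup.MapSubtype.orderIso H).trans (f.Iic H)).trans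
    (Subgroup.MapSubtype.orderIso (f H)).symm

theorem card_sup_of_disjoint {E : Type*} [CommGroup E] {P R : Subgroup E} (h : Disjoint P R) :
    Nat.card (P ⊔ R : Subgroup E) = Nat.card P * Nat.card R := by
  rw [← Subgroup.relIndex_bot_left (P ⊔ R),
    ← Subgroup.relIndex_mul_relIndex ⊥ R (P ⊔ R) bot_le le_sup_right,
    Subgroup.relIndex_sup_right, ← Subgroup.inf_relIndex_left P R, h.eq_bot,
    Subgroup.relIndex_bot_left, Subgroup.relIndex_bot_left, mul_comm]

theorem isPowerAutomorphism_of_mem_zpowers {A : Type*} [Group A] [Finite A] {φ : MulAut A}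
    (h : ∀ a, φ a ∈ Subgroup.zpowers a) : IsPowerAutomorphism φ := by
  intro B
  have hle : B.map φ.toMonoidHom ≤ B := by
    rintro _ ⟨b, hb, rfl⟩
    exact Subgroup.zpowers_le.2 hb (h b)
  refine Subgroup.eq_of_le_of_card_ge hle (le_of_eq ?_)
  exact Nat.card_congr (B.equivMapOfInjective φ.toMonoidHom φ.injective).toEquiv

theorem isElementaryAbelian_of_isAtom_top {T : Type*} [Group T] [Finite T]
    (h : IsAtom (⊤ : Subgroup T)) : IsElementaryAbelian (Nat.card T) T := by
  have hq := isAtom_iff_card_prime.1 h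
  rw [Subgroup.card_top] at hq
  have : Fact (Nat.card T).Prime := ⟨hq⟩
  have hc : IsCyclic T := isCyclic_of_prime_card rfl
  exact ⟨hq, hc.isMulCommutative.is_comm.comm, fun a => pow_card_eq_one'⟩

/-! ### Groups with the subgroup lattice of an elementary abelian group -/

section PGroup

variable {E T : Type*} [CommGroup E] [Group T] {p : ℕ}

theorem le_of_forall_isAtom_le (hp : p.Prime) {H : Subgroup E} (hH : ∀ x ∈ H, x ^ p = 1)
    (f : Subgroup E ≃o Subgroup T) {K : Subgroup T} (h : ∀ P ≤ f H, IsAtom P → P ≤ K) :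
    f H ≤ K := by
  have : Fact p.Prime := ⟨hp⟩
  rw [← f.le_symm_apply]
  intro x hx
  by_cases hx1 : x = 1
  · rw [hx1]; exact one_mem _
  · have h1 := h (f (Subgroup.zpowers x)) (f.monotone (by simpa using hx)) ((f.isAtom_iff _).2
      (isAtom_zpowers (by rwa [orderOf_eq_prime (hH x hx) hx1])))
    rw [← f.le_symm_apply] at h1
    exact h1 (Subgroup.mem_zpowers x)

theorem eq_top_of_forall_isAtom_le (hp : p.Prime) (hE : ∀ x : E, x ^ p = 1)
    (f : Subgroup E ≃o Subgroup T) {K : Subgroup T} (h : ∀ P, IsAtom P → P ≤ K) : K = ⊤ := by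
  rw [← top_le_iff, ← map_top f]
  exact le_of_forall_isAtom_le hp (fun x _ => hE x) f fun P _ => h P

variable [Finite E]

theorem isLine_sup (hp : p.Prime) (hE : ∀ x : E, x ^ p = 1)
    (f : Subgroup E ≃o Subgroup T) {P R : Subgroup T} (hP : IsAtom P) (hR : IsAtom R)
    (hne : P ≠ R) : IsLine p (Subgroup (P ⊔ R : Subgroup T)) := by
  have : Fact p.Prime := ⟨hp⟩
  have hcard : ∀ K : Subgroup E, IsAtom K → Nat.card K = p := by
    intro K hK
    obtain ⟨x, hx, rfl⟩ := exists_zpowers_eq_of_isAtom hK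
    rw [Nat.card_zpowers, orderOf_eq_prime (hE x)]
    rintro rfl
    exact hK.1 (by simp)
  have hP' := (f.symm.isAtom_iff P).2 hP
  have hR' := (f.symm.isAtom_iff R).2 hR
  have h := card_sup_of_disjoint (hP'.disjoint_of_ne hR' (f.symm.injective.ne hne))
  rw [hcard _ hP', hcard _ hR', ← sq, ← map_sup] at h
  have h2 := (IsLine.of_card_sq hp h fun x => Subtype.ext (hE x)).of_orderIso
    (restrictOrderIso f (f.symm (P ⊔ R)))
  rwa [f.apply_symm_apply] at h2

variable [Finite T]

theorem structure_sup (hp : p.Prime) (hE : ∀ x : E, x ^ p = 1)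
    (f : Subgroup E ≃o Subgroup T) {P R : Subgroup T} (hP : IsAtom P) (hR : IsAtom R)
    (hne : P ≠ R) :
    ((∀ x ∈ P ⊔ R, x ^ p = 1) ∧ ∀ x ∈ P ⊔ R, ∀ y ∈ P ⊔ R, x * y = y * x) ∨
    ∃ N ≤ P ⊔ R, IsAtom N ∧ Nat.card N = p ∧ (∀ g ∈ P ⊔ R, ∀ n ∈ N, g * n * g⁻¹ ∈ N) ∧
      ∀ S ≤ P ⊔ R, IsAtom S → S ≠ N →
        Nat.card S ≠ p ∧ (∃ n ∈ N, ∃ s ∈ S, n * s ≠ s * n) ∧ P ⊔ R ≤ N ⊔ S := by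
  have hline := isLine_sup hp hE f hP hR hne
  have hcard : ∀ K : Subgroup (P ⊔ R : Subgroup T),
      Nat.card (K.map (P ⊔ R).subtype) = Nat.card K := fun K =>
    Subgroup.card_map_of_injective (P ⊔ R).subtype_injective
  rcases hline.structure_of_isLine hp with ⟨h1, h2⟩ | ⟨N, hNn, hN, hNp, h⟩
  · exact Or.inl ⟨fun x hx => congrArg Subtype.val (h1 ⟨x, hx⟩),
      fun x hx y hy => congrArg Subtype.val (h2 ⟨x, hx⟩ ⟨y, hy⟩)⟩
  · refine Or.inr ⟨N.map (P ⊔ R).subtype, Subgroup.map_subtype_le N, ?_, ?_, ?_, ?_⟩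
    · rw [isAtom_iff_card_prime, hcard, hNp]; exact hp
    · rw [hcard, hNp]
    · rintro g hg _ ⟨n, hn, rfl⟩
      exact ⟨_, hNn.conj_mem n hn ⟨g, hg⟩, rfl⟩
    · intro S hS hSa hSN
      obtain ⟨S, rfl⟩ : ∃ S' : Subgroup (P ⊔ R : Subgroup T), S'.map (P ⊔ R).subtype = S :=
        ⟨S.subgroupOf (P ⊔ R), Subgroup.map_subgroupOf_eq_of_le hS⟩
      have hSa' : IsAtom S := by rwa [isAtom_iff_card_prime, hcard, ← isAtom_iff_card_prime] at hSa
      have hSN' : S ≠ N := fun h0 => hSN (by rw [h0])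
      obtain ⟨h1, n, hn, s, hs, h2⟩ := h S hSa' hSN'
      refine ⟨by rwa [hcard], ⟨n, ⟨n, hn, rfl⟩, s, ⟨s, hs, rfl⟩,
        fun h0 => h2 (Subtype.ext h0)⟩, ?_⟩
      rw [← Subgroup.map_sup, hline.sup_eq_top hN hSa' hSN'.symm, ← MonoidHom.range_eq_map,
        Subgroup.range_subtype]

/-- In the nonabelian alternative of `structure_sup` only one minimal subgroup has order `p`, so two
different ones generate an abelian group. -/
theorem mul_comm_of_pow_eq_one (hp : p.Prime) (hE : ∀ x : E, x ^ p = 1)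
    (f : Subgroup E ≃o Subgroup T) {x y : T} (hx : x ^ p = 1) (hy : y ^ p = 1) :
    x * y = y * x := by
  have : Fact p.Prime := ⟨hp⟩
  rcases eq_or_ne x 1 with rfl | hx1
  · simp
  rcases eq_or_ne y 1 with rfl | hy1
  · simp
  have hxo := orderOf_eq_prime hx hx1
  have hyo := orderOf_eq_prime hy hy1
  have hX : IsAtom (Subgroup.zpowers x) := isAtom_zpowers (by rwa [hxo])
  have hY : IsAtom (Subgroup.zpowers y) := isAtom_zpowers (by rwa [hyo])
  have hxm := Subgroup.mem_zpowers x
  have hym := Subgroup.mem_zpowers y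
  by_cases hne : Subgroup.zpowers x = Subgroup.zpowers y
  · rw [hne] at hxm
    obtain ⟨k, rfl⟩ := Subgroup.mem_zpowers_iff.1 hxm
    exact (Commute.refl y).zpow_left k
  · rcases structure_sup hp hE f hX hY hne with ⟨-, h⟩ | ⟨N, -, -, -, -, h⟩
    · exact h x (le_sup_left (a := Subgroup.zpowers x) hxm) y
        (le_sup_right (a := Subgroup.zpowers x) hym)
    · have h1 : Subgroup.zpowers x = N := by
        by_contra h0
        exact (h _ le_sup_left hX h0).1 (by rw [Nat.card_zpowers, hxo])
      have h2 : Subgroup.zpowers y = N := by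
        by_contra h0
        exact (h _ le_sup_right hY h0).1 (by rw [Nat.card_zpowers, hyo])
      exact absurd (h1.trans h2.symm) hne

/-- A finite group whose subgroup lattice is isomorphic to that of an elementary abelian group is
a `P`-group. -/
theorem isBaerPGroup_of_orderIso (hp : p.Prime) (hE : ∀ x : E, x ^ p = 1)
    (f : Subgroup E ≃o Subgroup T) : IsBaerPGroup T := by
  refine ⟨inferInstance, ?_⟩
  have : Fact p.Prime := ⟨hp⟩
  have hcomm : ∀ x y : T, x ^ p = 1 → y ^ p = 1 → x * y = y * x := fun x y hx hy =>
    mul_comm_of_pow_eq_one hp hE f hx hy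
  let A : Subgroup T :=
    { carrier := {x | x ^ p = 1}
      one_mem' := one_pow p
      mul_mem' := fun {x y} hx hy => by
        have hx : x ^ p = 1 := hx
        have hy : y ^ p = 1 := hy
        change (x * y) ^ p = 1
        rw [(show Commute x y from hcomm x y hx hy).mul_pow, hx, hy, one_mul]
      inv_mem' := fun {x} hx => by
        have hx : x ^ p = 1 := hx
        change x⁻¹ ^ p = 1
        rw [inv_pow, hx, inv_one] }
  have hAm : ∀ x, x ∈ A ↔ x ^ p = 1 := fun x => Iff.rfl
  have hAn : A.Normal := ⟨fun n hn g => by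
    rw [hAm] at hn ⊢
    rw [conj_pow, hn, mul_one, mul_inv_cancel]⟩
  have hAe : IsElementaryAbelian p A :=
    ⟨hp, fun a b => Subtype.ext (hcomm a b a.2 b.2), fun a => Subtype.ext a.2⟩
  have hleA : ∀ P : Subgroup T, Nat.card P = p → P ≤ A := by
    intro P hP x hx
    rw [hAm, ← hP]
    exact congrArg Subtype.val (pow_card_eq_one' (x := (⟨x, hx⟩ : P)))
  -- Any minimal subgroup of order other than `p` serves as the complement of `A`.
  by_cases hQ : ∃ Q : Subgroup T, IsAtom Q ∧ Nat.card Q ≠ p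
  swap
  · push Not at hQ
    have hA : A = ⊤ := eq_top_of_forall_isAtom_le hp hE f fun P hP => hleA P (hQ P hP)
    have hexp : ∀ x : T, x ^ p = 1 := fun x => by rw [← hAm, hA]; trivial
    exact Or.inl ⟨p, hp, fun a b => hcomm a b (hexp a) (hexp b), hexp⟩
  obtain ⟨Q, hQ, hQp⟩ := hQ
  by_cases hQt : Q = ⊤
  · exact Or.inl ⟨_, isElementaryAbelian_of_isAtom_top (hQt ▸ hQ)⟩
  have hq := isAtom_iff_card_prime.1 hQ
  have hQexp : ¬ ∀ x ∈ Q, x ^ p = 1 := by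
    intro h
    obtain ⟨x, hx, rfl⟩ := exists_zpowers_eq_of_isAtom hQ
    rw [Nat.card_zpowers] at hQp hq
    exact hQp ((Nat.prime_dvd_prime_iff_eq hq hp).1 (orderOf_dvd_of_pow_eq_one (h x hx)))
  -- As `Q` does not have exponent `p`, the join of `R` and `Q` is of the nonabelian kind; `N` is
  -- its normal subgroup of order `p`.
  have hstr : ∀ R : Subgroup T, IsAtom R → R ≠ Q →
      ∃ N ≤ A, IsAtom N ∧ Nat.card N = p ∧ (∀ g ∈ Q, ∀ n ∈ N, g * n * g⁻¹ ∈ N) ∧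
        (∃ n ∈ N, ∃ s ∈ Q, n * s ≠ s * n) ∧ R ≤ N ⊔ Q ∧ (Nat.card R = p → R = N) := by
    intro R hR hne
    rcases structure_sup hp hE f hR hQ hne with ⟨h, -⟩ | ⟨N, -, hN, hNp, hc, h⟩
    · exact absurd (fun x hx => h x (le_sup_right (a := R) hx)) hQexp
    · have hQN : Q ≠ N := fun h0 => hQp (h0 ▸ hNp)
      obtain ⟨-, h1, h2⟩ := h Q le_sup_right hQ hQN
      refine ⟨N, hleA N hNp, hN, hNp, fun g hg => hc g (le_sup_right (a := R) hg), h1,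
        le_sup_left.trans h2, fun hRp => ?_⟩
      by_contra h0
      exact (h R le_sup_left hR h0).1 hRp
  have hdisj : Disjoint A Q := by
    rw [disjoint_comm, ← hQ.not_le_iff_disjoint]
    exact fun hle => hQexp fun x hx => hle hx
  have hsup : A ⊔ Q = ⊤ := by
    refine eq_top_of_forall_isAtom_le hp hE f fun R hR => ?_
    by_cases hRQ : R = Q
    · rw [hRQ]; exact le_sup_right
    · obtain ⟨N, hNA, -, -, -, -, hle, -⟩ := hstr R hR hRQ
      exact hle.trans (sup_le_sup_right hNA Q)
  refine Or.inr ⟨p, Nat.card Q, A, Q, hAn, hAe, hq, hQp, rfl, ?_, ?_, ?_⟩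
  · refine Subgroup.isComplement'_of_disjoint_and_mul_eq_univ hdisj ?_
    rw [← Subgroup.normal_mul, hsup, Subgroup.coe_top]
  · intro x hx
    refine isPowerAutomorphism_of_mem_zpowers fun a => ?_
    rcases eq_or_ne a 1 with rfl | ha1
    · simp
    have hao : orderOf (a : T) = p := orderOf_eq_prime a.2 (by simpa using ha1)
    have hane : Subgroup.zpowers (a : T) ≠ Q := by
      rintro rfl
      exact hQp (by rw [Nat.card_zpowers, hao])
    -- The subgroup generated by `a` has order `p`, so it is the `N` of its join with `Q`, and `Q`
    -- normalizes it.
    obtain ⟨N, -, -, -, hc, -, -, hN⟩ := hstr _ (isAtom_zpowers (by rwa [hao])) hane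
    rw [← hN (by rw [Nat.card_zpowers, hao])] at hc
    obtain ⟨k, hk⟩ := Subgroup.mem_zpowers_iff.1 (hc x hx a (Subgroup.mem_zpowers _))
    exact Subgroup.mem_zpowers_iff.2 ⟨k, Subtype.ext (by simpa using hk)⟩
  · obtain ⟨R, hR, hRQ⟩ : ∃ R : Subgroup T, IsAtom R ∧ R ≠ Q := by
      by_contra! hno
      exact hQt (eq_top_of_forall_isAtom_le hp hE f fun P hP => (hno P hP).le)
    obtain ⟨N, hNA, -, -, -, ⟨n, hn, s, hs, hns⟩, -, -⟩ := hstr R hR hRQ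
    refine ⟨s, hs, fun h => hns ?_⟩
    have h1 := congrArg Subtype.val (DFunLike.congr_fun h (⟨n, hNA hn⟩ : A))
    rw [MulAut.conjNormal_apply] at h1
    exact (mul_inv_eq_iff_eq_mul.1 h1).symm

end PGroup

/-! ### Transporting the primary decomposition -/

section Decomposition

variable {X : Type*} [CommGroup X] [Finite X]

/-- For each prime power `p ^ k` dividing `|X|`, a subgroup of that order is killed by `p`, so `p ^
k` divides the order of the join. -/
theorem iSup_powMonoidHom_ker_eq_top
    (hX : ∀ (p k : ℕ) (x : X), p.Prime → x ^ p ^ k = 1 → x ^ p = 1) :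
    ⨆ p : {p // p ∈ (Nat.card X).primeFactors}, (powMonoidHom p.1 : X →* X).ker = ⊤ := by
  apply Subgroup.eq_top_of_card_eq
  refine Nat.dvd_antisymm (Subgroup.card_subgroup_dvd_card _)
    ((Nat.dvd_iff_prime_pow_dvd_dvd _ _).2 fun p k hp hpk => ?_)
  have : Fact p.Prime := ⟨hp⟩
  rcases Nat.eq_zero_or_pos k with rfl | hk
  · simp
  obtain ⟨K, hK⟩ := Sylow.exists_subgroup_card_pow_prime p hpk
  have hpm : p ∈ (Nat.card X).primeFactors :=
    Nat.mem_primeFactors.2 ⟨hp, (dvd_pow_self p hk.ne').trans hpk, Nat.card_pos.ne'⟩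
  rw [← hK]
  refine Subgroup.card_dvd_of_le (le_trans (fun x hx => ?_)
    (le_iSup (fun p : {p // p ∈ (Nat.card X).primeFactors} =>
      (powMonoidHom p.1 : X →* X).ker) ⟨p, hpm⟩))
  refine MonoidHom.mem_ker.2 (hX p k x hp ?_)
  rw [← hK]
  exact congrArg Subtype.val (pow_card_eq_one' (x := (⟨x, hx⟩ : K)))

theorem eq_or_eq_of_isAtom_le_sup {P Q R : Subgroup X} (hP : IsAtom P) (hQ : IsAtom Q)
    (hPQ : Nat.card P ≠ Nat.card Q) (hR : IsAtom R) (hle : R ≤ P ⊔ Q) : R = P ∨ R = Q := by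
  have hp := isAtom_iff_card_prime.1 hP
  have hq := isAtom_iff_card_prime.1 hQ
  have hne : P ≠ Q := fun h => hPQ (by rw [h])
  have hcard := card_sup_of_disjoint (hP.disjoint_of_ne hQ hne)
  by_contra! h
  have h1 : Nat.card R * Nat.card P ∣ Nat.card P * Nat.card Q := by
    rw [← hcard, ← card_sup_of_disjoint (hR.disjoint_of_ne hP h.1)]
    exact Subgroup.card_dvd_of_le (sup_le hle le_sup_left)
  have h2 : Nat.card R * Nat.card Q ∣ Nat.card P * Nat.card Q := by
    rw [← hcard, ← card_sup_of_disjoint (hR.disjoint_of_ne hQ h.2)]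
    exact Subgroup.card_dvd_of_le (sup_le hle le_sup_right)
  rw [mul_comm, Nat.mul_dvd_mul_iff_left hp.pos] at h1
  rw [Nat.mul_dvd_mul_iff_right hq.pos] at h2
  have hr := isAtom_iff_card_prime.1 hR
  exact hPQ (((Nat.prime_dvd_prime_iff_eq hr hp).1 h2).symm.trans
    ((Nat.prime_dvd_prime_iff_eq hr hq).1 h1))

/-- Two minimal subgroups whose join contains no other minimal subgroup centralize each other and
have different orders. -/
theorem commute_and_card_ne_of_isAtom {G : Type*} [Group G] [Finite G] {P Q : Subgroup G}
    (hP : IsAtom P) (hQ : IsAtom Q) (hPQ : P ≠ Q)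
    (h : ∀ R ≤ P ⊔ Q, IsAtom R → R = P ∨ R = Q) :
    (∀ x ∈ P, ∀ y ∈ Q, x * y = y * x) ∧ Nat.card P ≠ Nat.card Q := by
  have hdisj := hP.disjoint_of_ne hQ hPQ
  have hPle : P ≤ P ⊔ Q := le_sup_left
  have hQle : Q ≤ P ⊔ Q := le_sup_right
  have hconj : ∀ {K : Subgroup G}, K ≤ P ⊔ Q → ∀ g ∈ P ⊔ Q,
      K.map (MulAut.conj g).toMonoidHom ≤ P ⊔ Q := by
    rintro K hK g hg _ ⟨k, hk, rfl⟩
    exact mul_mem (mul_mem hg (hK hk)) (inv_mem hg)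
  have hfix : ∀ {K : Subgroup G}, ∀ g ∈ K, K.map (MulAut.conj g).toMonoidHom = K := by
    intro K g hg
    exact Subgroup.mem_normalizer_iff_map_conj_eq.1 (Subgroup.le_normalizer hg)
  have hinj : ∀ g : G, Function.Injective
      fun K : Subgroup G => K.map (MulAut.conj g).toMonoidHom :=
    fun g => (MulAut.conj g).mapSubgroup.injective
  have hcomm : ∀ x ∈ P, ∀ y ∈ Q, x * y = y * x := by
    intro x hx y hy
    -- Conjugation by `x` permutes the two atoms and fixes `P`, so it fixes `Q`; symmetrically for
    -- `y`. The commutator thus lies in `P ⊓ Q`.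
    have h1 : Q.map (MulAut.conj x).toMonoidHom = Q :=
      (h _ (hconj hQle x (hPle hx)) (isAtom_map_conj hQ x)).resolve_left fun h0 =>
        hPQ (hinj x (h0.trans (hfix x hx).symm)).symm
    have h2 : P.map (MulAut.conj y).toMonoidHom = P :=
      (h _ (hconj hPle y (hQle hy)) (isAtom_map_conj hP y)).resolve_right fun h0 =>
        hPQ (hinj y (h0.trans (hfix y hy).symm))
    have h3 : x * y * x⁻¹ * y⁻¹ ∈ Q :=
      mul_mem (h1.le ⟨y, hy, rfl⟩) (inv_mem hy)
    have h4 : x * y * x⁻¹ * y⁻¹ ∈ P := by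
      have : y * x⁻¹ * y⁻¹ ∈ P := h2.le ⟨x⁻¹, inv_mem hx, rfl⟩
      simpa only [mul_assoc] using mul_mem hx this
    have h5 := (Subgroup.disjoint_def.1 hdisj) h4 h3
    rw [mul_inv_eq_one, mul_inv_eq_iff_eq_mul] at h5
    exact h5
  refine ⟨hcomm, fun hcard => ?_⟩
  have hp := isAtom_iff_card_prime.1 hP
  have : Fact (Nat.card P).Prime := ⟨hp⟩
  obtain ⟨x, hx, hxP⟩ := exists_zpowers_eq_of_isAtom hP
  obtain ⟨y, hy, hyQ⟩ := exists_zpowers_eq_of_isAtom hQ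
  have hx1 : x ≠ 1 := by
    rintro rfl
    exact hP.1 (by simpa using hxP.symm)
  have hy1 : y ≠ 1 := by
    rintro rfl
    exact hQ.1 (by simpa using hyQ.symm)
  have hxp : x ^ Nat.card P = 1 := congrArg Subtype.val (pow_card_eq_one' (x := (⟨x, hx⟩ : P)))
  have hyp : y ^ Nat.card P = 1 := by
    rw [hcard]
    exact congrArg Subtype.val (pow_card_eq_one' (x := (⟨y, hy⟩ : Q)))
  -- With equal orders, `x * y` would generate a third atom.
  have hxy1 : x * y ≠ 1 := fun h0 =>
    hx1 (Subgroup.disjoint_def.1 hdisj hx (by rw [mul_eq_one_iff_eq_inv.1 h0]; exact inv_mem hy))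
  have hxyp : (x * y) ^ Nat.card P = 1 := by
    rw [(show Commute x y from hcomm x hx y hy).mul_pow, hxp, hyp, one_mul]
  have hxy := orderOf_eq_prime hxyp hxy1
  have hmem := Subgroup.mem_zpowers (x * y)
  rcases h (Subgroup.zpowers (x * y))
    (Subgroup.zpowers_le.2 (mul_mem (hPle hx) (hQle hy))) (isAtom_zpowers (hxy.symm ▸ hp))
    with h0 | h0
  · rw [h0] at hmem
    exact hy1 (Subgroup.disjoint_def.1 hdisj ((mul_mem_cancel_left hx).1 hmem) hy)
  · rw [h0] at hmem
    exact hx1 (Subgroup.disjoint_def.1 hdisj hx ((mul_mem_cancel_right hy).1 hmem))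

variable {G : Type*} [Group G] [Finite G]

/-- It is enough to compare minimal subgroups: they generate both images, and by Cauchy a common
prime divisor would give two of equal order. -/
theorem commute_and_coprime_of_orderIso (f : Subgroup X ≃o Subgroup G) {p q : ℕ} (hp : p.Prime)
    (hq : q.Prime) (hpq : p ≠ q) :
    (∀ x y : G, x ∈ f (powMonoidHom p).ker → y ∈ f (powMonoidHom q).ker → Commute x y) ∧
      (Nat.card (f (powMonoidHom p).ker)).Coprime (Nat.card (f (powMonoidHom q).ker)) := by
  have hcard : ∀ {r : ℕ} {P : Subgroup G}, r.Prime → IsAtom P →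
      P ≤ f (powMonoidHom r).ker → Nat.card (f.symm P) = r := by
    intro r P hr hP hle
    have : Fact r.Prime := ⟨hr⟩
    rw [← f.symm_apply_le] at hle
    obtain ⟨x, hx, hxP⟩ := exists_zpowers_eq_of_isAtom ((f.symm.isAtom_iff P).2 hP)
    rw [← hxP, Nat.card_zpowers]
    refine orderOf_eq_prime (MonoidHom.mem_ker.1 (hle hx)) ?_
    rintro rfl
    exact ((f.symm.isAtom_iff P).2 hP).1 (by simpa using hxP.symm)
  have key : ∀ P Q : Subgroup G, IsAtom P → IsAtom Q → P ≤ f (powMonoidHom p).ker →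
      Q ≤ f (powMonoidHom q).ker →
      (∀ x ∈ P, ∀ y ∈ Q, x * y = y * x) ∧ Nat.card P ≠ Nat.card Q := by
    intro P Q hP hQ hPle hQle
    have h1 : Nat.card (f.symm P) ≠ Nat.card (f.symm Q) := by
      rw [hcard hp hP hPle, hcard hq hQ hQle]
      exact hpq
    refine commute_and_card_ne_of_isAtom hP hQ (fun h => h1 (by rw [h])) fun R hle hR => ?_
    have h2 := eq_or_eq_of_isAtom_le_sup ((f.symm.isAtom_iff P).2 hP)
      ((f.symm.isAtom_iff Q).2 hQ) h1 ((f.symm.isAtom_iff R).2 hR)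
      (by rw [← map_sup]; exact f.symm.monotone hle)
    simpa using h2
  constructor
  · have h1 : f (powMonoidHom p).ker ≤
        Subgroup.centralizer (f (powMonoidHom q).ker : Subgroup G) := by
      refine le_of_forall_isAtom_le hp (fun x hx => hx) f fun P hPle hP => ?_
      rw [Subgroup.le_centralizer_iff]
      refine le_of_forall_isAtom_le hq (fun x hx => hx) f fun Q hQle hQ => ?_
      intro y hy
      rw [Subgroup.mem_centralizer_iff]
      exact fun x hx => (key P Q hP hQ hPle hQle).1 x hx y hy
    intro x y hx hy
    exact ((Subgroup.mem_centralizer_iff.1 (h1 hx)) y hy).symm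
  · by_contra h
    obtain ⟨r, hr, h1, h2⟩ := Nat.Prime.not_coprime_iff_dvd.1 h
    have : Fact r.Prime := ⟨hr⟩
    obtain ⟨x, hx⟩ := exists_prime_orderOf_dvd_card' r h1
    obtain ⟨y, hy⟩ := exists_prime_orderOf_dvd_card' r h2
    rw [← Subgroup.orderOf_coe] at hx hy
    refine (key (Subgroup.zpowers x) (Subgroup.zpowers y) (isAtom_zpowers (hx.symm ▸ hr))
      (isAtom_zpowers (hy.symm ▸ hr)) (by simp) (by simp)).2 ?_
    rw [Nat.card_zpowers, Nat.card_zpowers, hx, hy]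

end Decomposition

theorem nonempty_mulEquiv_pi_of_coprime {G : Type*} [Group G] [Finite G] {n : ℕ}
    {H : Fin n → Subgroup G}
    (hcomm : Pairwise fun i j => ∀ x y : G, x ∈ H i → y ∈ H j → Commute x y)
    (hcop : ∀ i j, i ≠ j → (Nat.card (H i)).Coprime (Nat.card (H j))) (htop : ⨆ i, H i = ⊤) :
    Nonempty (G ≃* (∀ i, H i)) := by
  have hfin : ∀ i, Fintype (H i) := fun i => Fintype.ofFinite _
  have hind : iSupIndep H := Subgroup.independent_of_coprime_order hcomm fun i j hij => by
    simpa only [Nat.card_eq_fintype_card] using hcop i j hij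
  refine ⟨(MulEquiv.ofBijective (Subgroup.noncommPiCoprod hcomm)
    ⟨Subgroup.injective_noncommPiCoprod_of_iSupIndep hind, ?_⟩).symm⟩
  rw [← MonoidHom.range_eq_top, Subgroup.noncommPiCoprod_range, htop]

theorem isCoprimeProductOfPGroups_of_subgroups {G : Type u} [Group G] [Finite G] {n : ℕ}
    {H : Fin n → Subgroup G} (hH : ∀ i, IsBaerPGroup (H i))
    (hcomm : ∀ i j, i ≠ j → (∀ x y : G, x ∈ H i → y ∈ H j → Commute x y) ∧
      (Nat.card (H i)).Coprime (Nat.card (H j))) (htop : ⨆ i, H i = ⊤) :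
    IsCoprimeProductOfPGroups G :=
  ⟨n, fun i => H i, fun _ => inferInstance, hH, fun i j hij => (hcomm i j hij).2,
    nonempty_mulEquiv_pi_of_coprime (fun i j hij => (hcomm i j hij).1)
      (fun i j hij => (hcomm i j hij).2) htop⟩

theorem isCoprimeProductOfPGroups_of_orderIso {X : Type*} [CommGroup X] [Finite X] {G : Type u}
    [Group G] [Finite G]
    (hX : ∀ (p k : ℕ) (x : X), p.Prime → x ^ p ^ k = 1 → x ^ p = 1)
    (f : Subgroup X ≃o Subgroup G) : IsCoprimeProductOfPGroups G := by
  obtain ⟨n, ⟨e⟩⟩ := Finite.exists_equiv_fin {p // p ∈ (Nat.card X).primeFactors}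
  have hprime : ∀ i, (e.symm i).1.Prime := fun i => Nat.prime_of_mem_primeFactors (e.symm i).2
  refine isCoprimeProductOfPGroups_of_subgroups
    (H := fun i => f (powMonoidHom (e.symm i).1).ker) (fun i => ?_) (fun i j hij => ?_) ?_
  · have hker : ∀ x : (powMonoidHom (e.symm i).1 : X →* X).ker, x ^ (e.symm i).1 = 1 := fun x =>
      Subtype.ext (MonoidHom.mem_ker.1 x.2)
    exact isBaerPGroup_of_orderIso (hprime i) hker (restrictOrderIso f _)
  · exact commute_and_coprime_of_orderIso f (hprime i) (hprime j) fun h =>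
      hij (e.symm.injective (Subtype.ext h))
  · rw [e.symm.iSup_comp (g := fun p : {p // p ∈ (Nat.card X).primeFactors} =>
      f (powMonoidHom p.1).ker), ← f.map_iSup, iSup_powMonoidHom_ker_eq_top hX, map_top]

theorem isCoprimeProductOfPGroups_of_hasNilpotentJoinGraph {G : Type u} [Group G] [Finite G]
    (hG : frattini G = ⊥) (h : HasNilpotentJoinGraph G) : IsCoprimeProductOfPGroups G := by
  obtain ⟨X, hXg, hXf, hXn, ⟨e⟩⟩ := h
  have hX := frattini_eq_bot_of_iso hG e
  have htor : ∀ (p k : ℕ) (x : X), p.Prime → x ^ p ^ k = 1 → x ^ p = 1 := fun p k x hp hx =>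
    pow_prime_eq_one_of_frattini_eq_bot hX hp hx
  have hcomm := commute_of_frattini_eq_bot hX
  let : CommGroup X := { hXg with mul_comm := hcomm }
  obtain ⟨f⟩ := nonempty_subgroup_orderIso_of_joinGraph_iso
    (isCoatomistic_of_frattini_eq_bot hX) e
  exact isCoprimeProductOfPGroups_of_orderIso htor f.symm

/-! ### Subgroups as preimages of subspaces -/

section CrossedHom

variable {p : ℕ} [Fact p.Prime] {T V : Type*} [Group T] [AddCommGroup V] [Module (ZMod p) V]

/-- The preimage of a subspace under a crossed homomorphism `θ`. -/
def crossedComap {θ : T → V} {μ : T →* ZMod p} (hθ : ∀ x y, θ (x * y) = θ x + μ x • θ y)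
    (W : Submodule (ZMod p) V) : Subgroup T where
  carrier := {x | θ x ∈ W}
  one_mem' := by
    have h := hθ 1 1
    rw [map_one, one_smul, mul_one] at h
    change θ 1 ∈ W
    rw [left_eq_add.1 h]
    exact zero_mem W
  mul_mem' := fun {x y} hx hy => by
    change θ (x * y) ∈ W
    rw [hθ]
    exact W.add_mem hx (W.smul_mem _ hy)
  inv_mem' := fun {x} hx => by
    have h1 := hθ 1 1
    rw [map_one, one_smul, mul_one] at h1
    have h := hθ x⁻¹ x
    rw [inv_mul_cancel, left_eq_add.1 h1] at h
    change θ x⁻¹ ∈ W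
    rw [eq_neg_of_add_eq_zero_left h.symm]
    exact W.neg_mem (W.smul_mem _ hx)

/-- Every vector has a nonzero multiple in the image of `θ`: itself if `c` kills it, otherwise one
rescaled to the value `c (θ x)`. So a subspace is determined by its preimage. -/
theorem crossedComap_le_iff {θ : T → V} {μ : T →* ZMod p} {c : V →ₗ[ZMod p] ZMod p}
    (hθ : ∀ x y, θ (x * y) = θ x + μ x • θ y) (hμ : ∀ x, μ x = 1 + c (θ x))
    (hrange : ∀ x v, c v = c (θ x) → ∃ y, θ y = v) (hne : ∃ x, μ x ≠ 1)
    {W W' : Submodule (ZMod p) V} : crossedComap hθ W ≤ crossedComap hθ W' ↔ W ≤ W' := by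
  refine ⟨fun h v hv => ?_, fun h x hx => h hx⟩
  by_cases hcv : c v = 0
  · obtain ⟨y, rfl⟩ := hrange 1 v (by simpa [hcv, eq_comm] using hμ 1)
    exact h hv
  · obtain ⟨x, hx⟩ := hne
    have hcx : c (θ x) ≠ 0 := fun h0 => hx (by rw [hμ, h0, add_zero])
    obtain ⟨y, hy⟩ := hrange x ((c (θ x) / c v) • v) (by
      rw [map_smul, smul_eq_mul, div_mul_cancel₀ _ hcv])
    have h1 : θ y ∈ W' := h (show θ y ∈ W by rw [hy]; exact W.smul_mem _ hv)
    rw [hy] at h1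
    exact (W'.smul_mem_iff (div_ne_zero hcx hcv)).1 h1

/-- On `H ⊓ ker μ` the map `θ` is additive, with image a subspace `W₀`. If `μ` is nontrivial at some
`x ∈ H`, the line through `θ x` is added; multiplying by a power of `x` brings any element back into
`ker μ`. -/
theorem exists_crossedComap_eq {θ : T → V} {μ : T →* ZMod p} {c : V →ₗ[ZMod p] ZMod p}
    (hθ : ∀ x y, θ (x * y) = θ x + μ x • θ y) (hμ : ∀ x, μ x = 1 + c (θ x))
    (hinj : Function.Injective θ)
    (hcyc : ∀ x, μ x ≠ 1 → ∀ y, ∃ z ∈ Subgroup.zpowers x, μ (y * z) = 1) (H : Subgroup T) :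
    ∃ W, crossedComap hθ W = H := by
  have h1 : θ 1 = 0 := by
    have h := hθ 1 1
    rw [map_one, one_smul, mul_one] at h
    exact left_eq_add.1 h
  let B : AddSubgroup V :=
    { carrier := {v | ∃ b ∈ H, μ b = 1 ∧ θ b = v}
      zero_mem' := ⟨1, one_mem H, map_one μ, h1⟩
      add_mem' := by
        rintro _ _ ⟨a, ha, ha1, rfl⟩ ⟨b, hb, hb1, rfl⟩
        exact ⟨a * b, mul_mem ha hb, by rw [map_mul, ha1, hb1, one_mul],
          by rw [hθ, ha1, one_smul]⟩
      neg_mem' := by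
        rintro _ ⟨a, ha, ha1, rfl⟩
        have h2 : μ a⁻¹ = 1 := by
          have := map_mul μ a a⁻¹
          rwa [mul_inv_cancel, map_one, ha1, one_mul, eq_comm] at this
        refine ⟨a⁻¹, inv_mem ha, h2, ?_⟩
        have := hθ a a⁻¹
        rw [mul_inv_cancel, h1, ha1, one_smul] at this
        exact eq_neg_of_add_eq_zero_right this.symm }
  let W₀ : Submodule (ZMod p) V := AddSubgroup.toZModSubmodule p B
  have hW₀ : ∀ v, v ∈ W₀ ↔ ∃ b ∈ H, μ b = 1 ∧ θ b = v := fun v => Iff.rfl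
  by_cases hH : ∀ x ∈ H, μ x = 1
  · refine ⟨W₀, le_antisymm (fun y hy => ?_) fun y hy => ⟨y, hy, hH y hy, rfl⟩⟩
    obtain ⟨b, hb, -, hby⟩ := (hW₀ _).1 hy
    rwa [← hinj hby]
  · push Not at hH
    obtain ⟨x, hx, hx1⟩ := hH
    have hcx : c (θ x) ≠ 0 := fun h0 => hx1 (by rw [hμ, h0, add_zero])
    have hxle : Subgroup.zpowers x ≤ crossedComap hθ (Submodule.span (ZMod p) {θ x}) :=
      Subgroup.zpowers_le.2 (Submodule.mem_span_singleton_self _)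
    have hspan : ∀ z ∈ Subgroup.zpowers x, θ z ∈ W₀ ⊔ Submodule.span (ZMod p) {θ x} :=
      fun z hz => (le_sup_right : _ ≤ W₀ ⊔ _) (hxle hz)
    refine ⟨W₀ ⊔ Submodule.span (ZMod p) {θ x}, le_antisymm (fun y hy => ?_) fun y hy => ?_⟩
    · obtain ⟨z, hz, hyz⟩ := hcyc x hx1 y
      have hzH : z ∈ H := Subgroup.zpowers_le.2 hx hz
      have h2 : θ (y * z) ∈ W₀ ⊔ Submodule.span (ZMod p) {θ x} := by
        rw [hθ]
        exact Submodule.add_mem _ hy (Submodule.smul_mem _ _ (hspan z hz))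
      obtain ⟨_, ⟨b, hb, hb1, rfl⟩, w, hw, hbw⟩ := Submodule.mem_sup.1 h2
      obtain ⟨t, rfl⟩ := Submodule.mem_span_singleton.1 hw
      have h3 := congrArg c hbw
      have hb0 : c (θ b) = 0 := by simpa [hb1] using hμ b
      have hyz0 : c (θ (y * z)) = 0 := by simpa [hyz] using hμ (y * z)
      rw [map_add, hb0, hyz0, map_smul, zero_add, smul_eq_mul, mul_eq_zero] at h3
      rw [h3.resolve_right hcx, zero_smul, add_zero] at hbw
      rw [hinj hbw] at hb
      exact (mul_mem_cancel_right hzH).1 hb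
    · obtain ⟨z, hz, hyz⟩ := hcyc x hx1 y
      have hzH : z ∈ H := Subgroup.zpowers_le.2 hx hz
      have h2 : θ (y * z) ∈ W₀ ⊔ Submodule.span (ZMod p) {θ x} :=
        (le_sup_left : W₀ ≤ _) ⟨y * z, mul_mem hy hzH, hyz, rfl⟩
      rw [hθ, Submodule.add_mem_iff_left _ (Submodule.smul_mem _ _ (hspan z hz))] at h2
      exact h2

end CrossedHom

/-! ### An abelian group with the lattice of a `P`-group -/

section NonabelianPGroup

theorem eq_of_smul_eq_smul_of_ne_zero {K V : Type*} [Field K] [AddCommGroup V] [Module K V]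
    {a b : K} {v : V} (hv : v ≠ 0) (h : a • v = b • v) : a = b :=
  smul_left_injective K hv h

theorem exists_smul_eq_of_mem_zpowers {p : ℕ} [Fact p.Prime] {A : Type*} [CommGroup A]
    [Module (ZMod p) (Additive A)] {φ : MulAut A} (h : ∀ a, φ a ∈ Subgroup.zpowers a) :
    ∃ m : ZMod p, ∀ a, Additive.ofMul (φ a) = m • Additive.ofMul a := by
  let F : Additive A →ₗ[ZMod p] Additive A :=
    (MonoidHom.toAdditive φ.toMonoidHom).toZModLinearMap p
  obtain ⟨m, hm⟩ := LinearMap.exists_eq_smul_id_of_forall_notLinearIndependent (f := F) (by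
    intro v hv
    obtain ⟨k, hk⟩ := Subgroup.mem_zpowers_iff.1 (h v.toMul)
    have hF : F v = (k : ZMod p) • v := by
      rw [Int.cast_smul_eq_zsmul]
      exact (congrArg Additive.ofMul hk).symm
    rw [LinearIndependent.pair_iff] at hv
    have := (hv (k : ZMod p) (-1) (by rw [hF, neg_one_smul, add_neg_cancel])).2
    exact one_ne_zero (neg_eq_zero.1 this))
  exact ⟨m, fun a => LinearMap.congr_fun hm (Additive.ofMul a)⟩

/-- Power automorphisms of `A` are scalars, giving a character `μ` of `H`. The condition on primes
preserves coprimality when several factors are replaced. -/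
theorem exists_orderIso_of_isNonabelianPGroup {H : Type u} [Group H] [Finite H]
    (h : IsNonabelianPGroup H) :
    ∃ (E : Type u) (_ : CommGroup E), Finite E ∧
      (∀ r : ℕ, r.Prime → r ∣ Nat.card E → r ∣ Nat.card H) ∧
      Nonempty (Subgroup H ≃o Subgroup E) := by
  obtain ⟨p, q, A, Q, hAn, ⟨hp, hAc, hAe⟩, hq, -, hQq, hAQ, hpow, x₀, hx₀Q, hx₀⟩ := h
  have : Fact p.Prime := ⟨hp⟩
  let : CommGroup A := { (inferInstance : Group A) with mul_comm := hAc }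
  let : Module (ZMod p) (Additive A) := AddCommGroup.zmodModule fun a => hAe a.toMul
  have hmul : ∀ a ∈ A, ∀ x : H,
      (MulAut.conjNormal (a * x) : MulAut A) = MulAut.conjNormal x := by
    intro a ha x
    ext b
    rw [map_mul, MulAut.mul_apply]
    have h1 : (MulAut.conjNormal a : MulAut A) (MulAut.conjNormal x b) =
        MulAut.conjNormal x b := by
      refine Subtype.ext ?_
      rw [MulAut.conjNormal_apply, mul_inv_eq_iff_eq_mul]
      exact congrArg Subtype.val (hAc ⟨a, ha⟩ (MulAut.conjNormal x b))
    rw [h1]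
  let α : H → A := fun x => (hAQ.equiv x).1
  let κ : H → Q := fun x => (hAQ.equiv x).2
  have hακ : ∀ x, (α x : H) * κ x = x := fun x => hAQ.equiv_fst_mul_equiv_snd x
  have hα : ∀ (a : A) (t : Q), α (a * t) = a ∧ κ (a * t) = t := by
    intro a t
    have := hAQ.equiv.apply_symm_apply (a, t)
    exact ⟨congrArg Prod.fst this, congrArg Prod.snd this⟩
  have hκ : ∀ x, (MulAut.conjNormal x : MulAut A) = MulAut.conjNormal (κ x : H) := by
    intro x
    nth_rewrite 1 [← hακ x]
    exact hmul _ (α x).2 _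
  have hscal : ∀ x : H, ∃ m : ZMod p, ∀ a : A,
      Additive.ofMul ((MulAut.conjNormal x : MulAut A) a) = m • Additive.ofMul a := by
    intro x
    rw [hκ]
    refine exists_smul_eq_of_mem_zpowers fun a => ?_
    have h1 := hpow (κ x) (κ x).2 (Subgroup.zpowers a)
    exact h1.le ⟨a, Subgroup.mem_zpowers a, rfl⟩
  choose m hm using hscal
  obtain ⟨a₀, ha₀⟩ : ∃ a : A, a ≠ 1 := by
    by_contra! hno
    refine hx₀ (MulEquiv.ext fun a => ?_)
    rw [hno a, map_one, map_one]
  have huniq : ∀ x (k : ZMod p), (∀ a : A, Additive.ofMul ((MulAut.conjNormal x : MulAut A) a) =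
      k • Additive.ofMul a) → m x = k := by
    intro x k hk
    have h1 : Additive.ofMul a₀ ≠ 0 := ha₀
    exact eq_of_smul_eq_smul_of_ne_zero h1 ((hm x a₀).symm.trans (hk a₀))
  let μ : H →* ZMod p :=
    { toFun := m
      map_one' := huniq 1 1 fun a => by rw [map_one, one_smul, MulAut.one_apply]
      map_mul' := fun x y => huniq _ _ fun a => by
        rw [map_mul, MulAut.mul_apply, hm, hm, mul_smul] }
  have hμκ : ∀ x, μ x = μ (κ x) := fun x => huniq _ _ fun a => by rw [hκ]; exact hm _ a
  have hQz : ∀ t : Q, μ t ≠ 1 → ∀ s : Q, (s : H) ∈ Subgroup.zpowers (t : H) := by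
    intro t ht s
    have : Fact (Nat.card Q).Prime := ⟨hQq ▸ hq⟩
    have ht1 : t ≠ 1 := fun h0 => ht (by rw [h0, Subgroup.coe_one, map_one])
    obtain ⟨k, hk⟩ := Subgroup.mem_zpowers_iff.1 (mem_zpowers_of_prime_card rfl ht1 (g' := s))
    exact Subgroup.mem_zpowers_iff.2 ⟨k, by rw [← hk, Subgroup.coe_zpow]⟩
  have hx₀μ : μ x₀ ≠ 1 := by
    intro h0
    refine hx₀ (MulEquiv.ext fun a => ?_)
    have := hm x₀ a
    rw [show m x₀ = 1 from h0, one_smul] at this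
    exact this
  have hμ1 : ∀ t : Q, μ t = 1 → t = 1 := by
    intro t ht
    by_contra ht1
    have : Fact (Nat.card Q).Prime := ⟨hQq ▸ hq⟩
    obtain ⟨k, hk⟩ := Subgroup.mem_zpowers_iff.1
      (mem_zpowers_of_prime_card rfl ht1 (g' := (⟨x₀, hx₀Q⟩ : Q)))
    have hk' : (t : H) ^ k = x₀ := congrArg Subtype.val hk
    have h1 : (t : H) ∈ μ.ker := ht
    exact hx₀μ (by rw [← hk']; exact zpow_mem h1 k)
  -- Both coordinates are crossed homomorphisms for `μ`: the `A`-part because `x` acts on `A` by `μ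
  -- x`, and `μ - 1` by multiplicativity. The second separates elements of `Q`, where `μ` is
  -- injective.
  let θ : H → Additive A × ZMod p := fun x => (Additive.ofMul (α x), μ x - 1)
  let c : Additive A × ZMod p →ₗ[ZMod p] ZMod p := LinearMap.snd _ _ _
  have hθ : ∀ x y, θ (x * y) = θ x + μ x • θ y := by
    intro x y
    have h1 : x * y = (α x * (MulAut.conjNormal x : MulAut A) (α y) : A) * (κ x * κ y : Q) := by
      rw [hκ x]
      simp only [Subgroup.coe_mul, MulAut.conjNormal_apply]
      nth_rewrite 1 [← hακ x, ← hακ y]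
      group
    have h2 : α (x * y) = α x * (MulAut.conjNormal x : MulAut A) (α y) := by
      nth_rewrite 1 [h1]
      exact (hα _ _).1
    refine Prod.ext ?_ ?_
    · change Additive.ofMul (α (x * y)) = Additive.ofMul (α x) + m x • Additive.ofMul (α y)
      rw [h2, ofMul_mul, hm]
    · change μ (x * y) - 1 = μ x - 1 + μ x * (μ y - 1)
      rw [map_mul]
      ring
  have hμc : ∀ x, μ x = 1 + c (θ x) := fun x => (add_sub_cancel 1 (μ x)).symm
  have hinj : Function.Injective θ := by
    intro x y hxy
    have h1 : α x = α y := (Prod.ext_iff.1 hxy).1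
    have h2 : μ x = μ y := sub_left_injective (Prod.ext_iff.1 hxy).2
    have h3 : κ x = κ y := by
      rw [← mul_inv_eq_one]
      refine hμ1 _ ?_
      rw [hμκ x, hμκ y] at h2
      rw [Subgroup.coe_mul, map_mul, h2, ← map_mul, ← Subgroup.coe_mul, mul_inv_cancel,
        Subgroup.coe_one, map_one]
    rw [← hακ x, ← hακ y, h1, h3]
  have hrange : ∀ x v, c v = c (θ x) → ∃ y, θ y = v := by
    rintro x ⟨a, t⟩ ht
    have ht' : t = μ x - 1 := ht
    refine ⟨a.toMul * κ x, Prod.ext ?_ ?_⟩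
    · exact congrArg Additive.ofMul (hα _ _).1
    · change μ _ - 1 = t
      rw [ht', hμκ (a.toMul * κ x), (hα _ _).2, ← hμκ]
  have hcyc : ∀ x, μ x ≠ 1 → ∀ y, ∃ z ∈ Subgroup.zpowers x, μ (y * z) = 1 := by
    intro x hx y
    obtain ⟨k, hk⟩ := Subgroup.mem_zpowers_iff.1 (hQz (κ x) (by rwa [← hμκ]) (κ y)⁻¹)
    refine ⟨x ^ k, Subgroup.zpow_mem_zpowers x k, ?_⟩
    have h1 : ∀ x, μ.toHomUnits x = μ.toHomUnits (κ x : H) := fun x => Units.ext (hμκ x)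
    have h2 : μ.toHomUnits (y * x ^ k) = 1 := by
      rw [map_mul, map_zpow, h1 x, h1 y, ← map_zpow, hk, ← map_mul, Subgroup.coe_inv,
        mul_inv_cancel, map_one]
    exact congrArg Units.val h2
  let F : Submodule (ZMod p) (Additive A × ZMod p) ↪o Subgroup H :=
    OrderEmbedding.ofMapLEIff (crossedComap hθ) fun _ _ =>
      crossedComap_le_iff hθ hμc hrange ⟨x₀, hx₀μ⟩
  let F' : Submodule (ZMod p) (Additive A × ZMod p) ≃o Subgroup H :=
    OrderIso.ofSurjective F fun K => exists_crossedComap_eq hθ hμc hinj hcyc K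
  refine ⟨Multiplicative (Additive A × ZMod p), inferInstance, inferInstance, ?_,
    ⟨(F'.symm.trans (AddSubgroup.toZModSubmodule p).symm).trans AddSubgroup.toSubgroup⟩⟩
  intro r hr hrE
  have hcard : Nat.card (Multiplicative (Additive A × ZMod p)) = Nat.card A * p := by
    change Nat.card (A × ZMod p) = _
    rw [Nat.card_prod, Nat.card_zmod]
  rw [hcard, hr.dvd_mul] at hrE
  refine dvd_trans ?_ (Subgroup.card_subgroup_dvd_card A)
  rcases hrE with h1 | h1
  · exact h1
  · rw [(Nat.prime_dvd_prime_iff_eq hr hp).1 h1, ← orderOf_eq_prime (hAe a₀) ha₀]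
    exact orderOf_dvd_natCard a₀

theorem exists_orderIso_of_isBaerPGroup {H : Type u} [hH : Group H] (h : IsBaerPGroup H) :
    ∃ (E : Type u) (_ : CommGroup E), Finite E ∧
      (∀ r : ℕ, r.Prime → r ∣ Nat.card E → r ∣ Nat.card H) ∧
      Nonempty (Subgroup H ≃o Subgroup E) := by
  obtain ⟨hf, ⟨p, hp⟩ | h⟩ := h
  · exact ⟨H, { hH with mul_comm := hp.comm }, hf, fun r _ hr => hr, ⟨OrderIso.refl _⟩⟩
  · exact exists_orderIso_of_isNonabelianPGroup h

end NonabelianPGroup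

/-! ### Products of coprime orders -/

section CoprimeProduct

variable {ι : Type*} [Finite ι] {H : ι → Type*} [∀ i, Group (H i)]

theorem mulSingle_mem_of_coprime [DecidableEq ι]
    (hcop : ∀ i j, i ≠ j → (Nat.card (H i)).Coprime (Nat.card (H j))) {K : Subgroup (∀ i, H i)}
    {k : ∀ i, H i} (hk : k ∈ K) (i : ι) : Pi.mulSingle i (k i) ∈ K := by
  have : Fintype ι := Fintype.ofFinite ι
  have hc : (Nat.card (H i)).Coprime (∏ j ∈ Finset.univ.erase i, Nat.card (H j)) :=
    Nat.Coprime.prod_right fun j hj => hcop i j (Finset.ne_of_mem_erase hj).symm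
  -- The `m`-th power keeps the coordinate `i` and kills all others.
  obtain ⟨m, hm1, hm0⟩ := Nat.chineseRemainder hc 1 0
  have h1 : Pi.mulSingle i (k i) = k ^ m := by
    ext j
    rw [Pi.pow_apply]
    rcases eq_or_ne j i with rfl | hj
    · rw [Pi.mulSingle_eq_same]
      have := (pow_eq_pow_iff_modEq (x := k j)).2 (hm1.of_dvd (orderOf_dvd_natCard (k j)))
      rw [this, pow_one]
    · rw [Pi.mulSingle_eq_of_ne hj]
      refine (orderOf_dvd_iff_pow_eq_one.1 ((orderOf_dvd_natCard (k j)).trans ?_)).symm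
      exact (Finset.dvd_prod_of_mem _ (Finset.mem_erase.2 ⟨hj, Finset.mem_univ j⟩)).trans
        ((Nat.modEq_zero_iff_dvd).1 hm0)
  rw [h1]
  exact pow_mem hk m

/-- The subgroup lattice of a direct product of groups of pairwise coprime orders is the product of
the subgroup lattices. -/
theorem nonempty_pi_subgroup_orderIso
    (hcop : ∀ i j, i ≠ j → (Nat.card (H i)).Coprime (Nat.card (H j))) :
    Nonempty ((∀ i, Subgroup (H i)) ≃o Subgroup (∀ i, H i)) := by
  classical
  let F : (∀ i, Subgroup (H i)) ↪o Subgroup (∀ i, H i) :=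
    OrderEmbedding.ofMapLEIff (Subgroup.pi Set.univ) fun W W' => by
      refine ⟨fun h i x hx => ?_, fun h x hx i hi => h i (hx i hi)⟩
      have h1 : Pi.mulSingle i x ∈ Subgroup.pi Set.univ W := by
        intro j _
        rcases eq_or_ne j i with rfl | hj
        · rwa [Pi.mulSingle_eq_same]
        · rw [Pi.mulSingle_eq_of_ne hj]
          exact one_mem (W j)
      simpa using h h1 i (Set.mem_univ i)
  refine ⟨OrderIso.ofSurjective F fun K =>
    ⟨fun i => K.map (Pi.evalMonoidHom H i), le_antisymm (fun x hx => ?_) fun x hx i _ =>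
      ⟨x, hx, rfl⟩⟩⟩
  refine Subgroup.pi_mem_of_mulSingle_mem x fun i => ?_
  obtain ⟨k, hk, hki⟩ := hx i (Set.mem_univ i)
  have hki' : k i = x i := hki
  rw [← hki']
  exact mulSingle_mem_of_coprime hcop hk i

end CoprimeProduct

theorem nonempty_pi_orderIso_congr {ι : Type*} {α β : ι → Type*} [∀ i, LE (α i)] [∀ i, LE (β i)]
    (f : ∀ i, α i ≃o β i) : Nonempty ((∀ i, α i) ≃o ∀ i, β i) :=
  ⟨{ toEquiv := Equiv.piCongrRight fun i => (f i).toEquiv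
     map_rel_iff' := forall_congr' fun i => (f i).le_iff_le }⟩

theorem hasNilpotentJoinGraph_of_isCoprimeProductOfPGroups {G : Type u} [Group G]
    (h : IsCoprimeProductOfPGroups G) : HasNilpotentJoinGraph G := by
  obtain ⟨n, H, hH, hP, hcop, ⟨e⟩⟩ := h
  choose E hE hfin hdvd hiso using fun i => exists_orderIso_of_isBaerPGroup (hP i)
  have hcopE : ∀ i j, i ≠ j → (Nat.card (E i)).Coprime (Nat.card (E j)) := by
    intro i j hij
    by_contra hc
    obtain ⟨r, hr, h1, h2⟩ := Nat.Prime.not_coprime_iff_dvd.1 hc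
    exact Nat.Prime.not_coprime_iff_dvd.2 ⟨r, hr, hdvd i r hr h1, hdvd j r hr h2⟩ (hcop i j hij)
  obtain ⟨f₁⟩ := nonempty_pi_subgroup_orderIso hcop
  obtain ⟨f₂⟩ := nonempty_pi_subgroup_orderIso hcopE
  obtain ⟨f₃⟩ := nonempty_pi_orderIso_congr fun i => (hiso i).some
  exact ⟨∀ i, E i, inferInstance, inferInstance, inferInstance,
    nonempty_joinGraph_iso_of_subgroup_orderIso
      (((e.mapSubgroup.trans f₁.symm).trans f₃).trans f₂)⟩

end FiniteGroup

theorem proposition1p5 (G : Type u) [Group G] [Finite G] (hG : frattini G = ⊥) :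
    FiniteGroup.HasNilpotentJoinGraph G ↔ FiniteGroup.IsCoprimeProductOfPGroups G :=
  ⟨FiniteGroup.isCoprimeProductOfPGroups_of_hasNilpotentJoinGraph hG,
    FiniteGroup.hasNilpotentJoinGraph_of_isCoprimeProductOfPGroups⟩
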